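/- Let $\Bbbk$ be a field, let $\alpha,\beta,\gamma\in\Bbbk\setminus\{0\}$, and let $r_m^{(1,2)}, r_m^{(1,3)}, r_m^{(2,3)}\in\Bbbk$ for $0\le m\le 3$. Write $r^{(i,j)}=r_0^{(i,j)}+r_1^{(i,j)}x_1+r_2^{(i,j)}x_2+r_3^{(i,j)}x_3$, and let $A$ be the associative unital $\Bbbk$-algebra generated by $x_1,x_2,x_3$ with the relations $$x_3x_2=\alpha^{-1}x_2x_3+r^{(2,3)},\qquad x_3x_1=\beta x_1x_3+r^{(1,3)},\qquad x_2x_1=\gamma^{-1}x_1x_2+r^{(1,2)},$$ that is, the quotient of the free algebra $\Bbbk\langle x_1,x_2,x_3\rangle$ by the two-sided ideal generated by these relations. An algebra is called a 3-dimensional skew polynomial algebra in the variables $x,y,z$ if it is the $\Bbbk$-algebra generated by $x,y,z$ subject to relations $yz-\alpha' zy=\lambda$, $zx-\beta' xz=\mu$, $xy-\gamma' yx=\nu$ with $\alpha',\beta',\gamma'\in\Bbbk\setminus\{0\}$ and $\lambda,\mu,\nu\in\Bbbk+\Bbbk x+\Bbbk y+\Bbbk z$, and the standard monomials $x^iy^jz^l$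 $(i,j,l\ge 0)$ form a $\Bbbk$-basis of it. Then $A$ is a 3-dimensional skew polynomial algebra in the variables $x_1,x_2,x_3$ (so that the monomials $x_1^ix_2^jx_3^l$ form a $\Bbbk$-basis of $A$) if and only if the following ten equations hold in $\Bbbk$: \begin{align*} \gamma^{-1}\beta r_0^{(2,3)}+\gamma^{-1}r_3^{(1,3)}r_1^{(2,3)}+r_1^{(1,2)}r_1^{(1,3)}+r_2^{(1,2)}r_1^{(2,3)}&=\alpha^{-1}r_1^{(1,2)}r_1^{(1,3)}+r_0^{(2,3)}+r_1^{(1,2)}r_2^{(2,3)}+r_1^{(1,3)}r_3^{(2,3)},\\ \gamma^{-1}r_0^{(1,3)}+\gamma^{-1}r_3^{(1,3)}r_2^{(2,3)}+r_1^{(1,2)}r_2^{(1,3)}+r_2^{(1,2)}r_2^{(2,3)}&=\alpha^{-1}r_0^{(1,3)}+\alpha^{-1}r_1^{(1,3)}r_2^{(1,2)}+r_2^{(1,2)}r_2^{(2,3)}+r_2^{(1,3)}r_3^{(2,3)},\\ \gamma^{-1}r_3^{(1,3)}r_3^{(2,3)}+r_0^{(1,2)}+r_1^{(1,2)}r_3^{(1,3)}+r_2^{(1,2)}r_3^{(2,3)}&=\beta\alpha^{-1}r_0^{(1,2)}+\alpha^{-1}r_1^{(1,3)}r_3^{(1,2)}+r_2^{(2,3)}r_3^{(1,2)}+r_3^{(1,3)}r_3^{(2,3)},\\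 \gamma^{-1}r_1^{(1,3)}+\gamma^{-1}\beta r_2^{(2,3)}&=\gamma^{-1}\alpha^{-1}r_1^{(1,3)}+\gamma^{-1}r_2^{(2,3)},\\ \gamma^{-1}\beta r_3^{(2,3)}+\beta r_1^{(1,2)}&=\beta\alpha^{-1}r_1^{(1,2)}+\beta r_3^{(2,3)},\\ \gamma^{-1}\alpha^{-1}r_3^{(1,3)}+\alpha^{-1}r_2^{(1,2)}&=\beta\alpha^{-1}r_2^{(1,2)}+\alpha^{-1}r_3^{(1,3)},\\ \gamma^{-1}\beta r_1^{(2,3)}&=r_1^{(2,3)},\\ \gamma^{-1}r_2^{(1,3)}&=\alpha^{-1}r_2^{(1,3)},\\ r_3^{(1,2)}&=\beta\alpha^{-1}r_3^{(1,2)},\\ \gamma^{-1}r_3^{(1,3)}r_0^{(2,3)}+r_1^{(1,2)}r_0^{(1,3)}+r_2^{(1,2)}r_0^{(2,3)}&=\alpha^{-1}r_0^{(1,2)}r_1^{(1,3)}+r_0^{(1,2)}r_2^{(2,3)}+r_0^{(1,3)}r_3^{(2,3)}. \end{align*} -/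

import Mathlib

noncomputable section

namespace SkewPoly

/-- The free associative algebra `k⟨x₁, x₂, x₃⟩`; the variable `xᵢ` has index `i - 1`. -/
abbrev Free3 (k : Type*) [Field k] : Type _ := FreeAlgebra k (Fin 3)

/-- The variables of `k⟨x₁, x₂, x₃⟩`. -/
abbrev X (k : Type*) [Field k] (i : Fin 3) : Free3 k := FreeAlgebra.ι k i

/-- The affine-linear form `r₀ + r₁ x₁ + r₂ x₂ + r₃ x₃` in `k⟨x₁, x₂, x₃⟩`. -/
def affine {k : Type*} [Field k] (r : Fin 4 → k) : Free3 k :=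
  algebraMap k (Free3 k) (r 0) + r 1 • X k 0 + r 2 • X k 1 + r 3 • X k 2

/-- The family `x` generates the `k`-algebra `A`, with defining relations `f = 0` for `f ∈ R`:
the homomorphism `k⟨x₁, x₂, x₃⟩ → A` given by `x` is onto, and its kernel is the two-sided ideal
generated by `R`. -/
def IsPresentedBy {k A : Type*} [Field k] [Ring A] [Algebra k A] (x : Fin 3 → A)
    (R : Set (Free3 k)) : Prop :=
  Function.Surjective (FreeAlgebra.lift k x) ∧
    TwoSidedIdeal.ker (FreeAlgebra.lift k x) = TwoSidedIdeal.span R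

/-- The standard monomials `x₁ ^ i * x₂ ^ j * x₃ ^ l`, indexed by `(i, j, l)`. -/
def stdMonomial {A : Type*} [Ring A] (x : Fin 3 → A) (m : ℕ × ℕ × ℕ) : A :=
  x 0 ^ m.1 * x 1 ^ m.2.1 * x 2 ^ m.2.2

/-- `A` is a 3-dimensional skew polynomial algebra in the variables `x, y, z = x₁, x₂, x₃`: it is
the algebra generated by them subject to the relations `yz - α zy = lam`, `zx - β xz = mu` and
`xy - γ yx = nu`, where `α, β, γ` are nonzero scalars and `lam, mu, nu ∈ k + kx + ky + kz`, and the
standard monomials `x ^ i * y ^ j * z ^ l` are a `k`-basis of `A`. -/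
def IsSkewPolynomialAlgebra (k : Type*) {A : Type*} [Field k] [Ring A] [Algebra k A]
    (x : Fin 3 → A) : Prop :=
  (∃ (α β γ : k) (lam mu nu : Fin 4 → k), α ≠ 0 ∧ β ≠ 0 ∧ γ ≠ 0 ∧
    IsPresentedBy x
      {X k 1 * X k 2 - α • (X k 2 * X k 1) - affine lam,
       X k 2 * X k 0 - β • (X k 0 * X k 2) - affine mu,
       X k 0 * X k 1 - γ • (X k 1 * X k 0) - affine nu}) ∧
  LinearIndependent k (stdMonomial x) ∧ Submodule.span k (Set.range (stdMonomial x)) = ⊤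

/-- The two-sided ideal of `k⟨x₁, x₂, x₃⟩` generated by the relations
`x₃x₂ = α⁻¹ x₂x₃ + r₂₃`, `x₃x₁ = β x₁x₃ + r₁₃` and `x₂x₁ = γ⁻¹ x₁x₂ + r₁₂`. -/
def relIdeal {k : Type*} [Field k] (α β γ : k) (r12 r13 r23 : Fin 4 → k) :
    TwoSidedIdeal (Free3 k) :=
  TwoSidedIdeal.span
    {X k 2 * X k 1 - (α⁻¹ • (X k 1 * X k 2) + affine r23),
     X k 2 * X k 0 - (β • (X k 0 * X k 2) + affine r13),
     X k 1 * X k 0 - (γ⁻¹ • (X k 0 * X k 1) + affine r12)}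

/-- The algebra generated by `x₁, x₂, x₃` with the relations
`x₃x₂ = α⁻¹ x₂x₃ + r₂₃`, `x₃x₁ = β x₁x₃ + r₁₃` and `x₂x₁ = γ⁻¹ x₁x₂ + r₁₂`. -/
abbrev RelAlgebra {k : Type*} [Field k] (α β γ : k) (r12 r13 r23 : Fin 4 → k) : Type _ :=
  (relIdeal α β γ r12 r13 r23).ringCon.Quotient

/-- The generators `x₁, x₂, x₃` of `RelAlgebra`: the classes of the variables. -/
def gen {k : Type*} [Field k] (α β γ : k) (r12 r13 r23 : Fin 4 → k) (i : Fin 3) :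
    RelAlgebra α β γ r12 r13 r23 :=
  (relIdeal α β γ r12 r13 r23).ringCon.mk' (X k i)

end SkewPoly

end

/-! Read the relations as rewriting rules sorting words into the order `x₁, x₂, x₃`. The only
overlap is `x₃x₂x₁`. Reducing it in two ways gives the same cubic term, and equality of the ten
remaining coefficients is `OverlapResolvable`; this is Bergman's diamond lemma for one ambiguity,
proved here by hand.

The standard monomials always span, by induction on degree (`SatisfiesRelations.span_stdMonomial`).
If they are independent, comparing coefficients in `(x₃x₂)x₁ = x₃(x₂x₁)` gives the ten equations
(`SatisfiesRelations.overlapResolvable`).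

Conversely, operators `opX`, `opY`, `opZ` are built on the free module on the standard monomials.
Two of the relations hold by construction; the ten equations give the third
(`OverlapResolvable.opZ_opY`). So the algebra acts on this module, and its standard monomials send
the basis vector of index `(0, 0, 0)` to distinct basis vectors, hence are independent. -/

noncomputable section

namespace SkewPoly

variable {k : Type*} [Field k]

/-! ### The overlap `x₃ x₂ x₁` -/

/-- The ten scalar equations expressing that the overlap `x₃ x₂ x₁` of the rewriting rules
`x₃x₂ → a x₂x₃ + s`, `x₃x₁ → b x₁x₃ + q`, `x₂x₁ → c x₁x₂ + p` is resolvable. -/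
structure OverlapResolvable (a b c : k) (p q s : Fin 4 → k) : Prop where
  coeff_x : c * b * s 0 + c * q 3 * s 1 + p 1 * q 1 + p 2 * s 1
    = a * p 1 * q 1 + s 0 + p 1 * s 2 + q 1 * s 3
  coeff_y : c * q 0 + c * q 3 * s 2 + p 1 * q 2 + p 2 * s 2
    = a * q 0 + a * q 1 * p 2 + p 2 * s 2 + q 2 * s 3
  coeff_z : c * q 3 * s 3 + p 0 + p 1 * q 3 + p 2 * s 3
    = b * a * p 0 + a * q 1 * p 3 + s 2 * p 3 + q 3 * s 3
  coeff_xy : c * q 1 + c * b * s 2 = c * a * q 1 + c * s 2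
  coeff_xz : c * b * s 3 + b * p 1 = b * a * p 1 + b * s 3
  coeff_yz : c * a * q 3 + a * p 2 = b * a * p 2 + a * q 3
  coeff_xx : c * b * s 1 = s 1
  coeff_yy : c * q 2 = a * q 2
  coeff_zz : p 3 = b * a * p 3
  coeff_one : c * q 3 * s 0 + p 1 * q 0 + p 2 * s 0 = a * p 0 * q 1 + p 0 * s 2 + q 0 * s 3

section Operators

variable {V : Type*} [AddCommGroup V] [Module k V]

/-- The affine combination `r₀ + r₁ x + r₂ y + r₃ z` of three operators. -/
def affineOp (r : Fin 4 → k) (x y z : V →ₗ[k] V) : V →ₗ[k] V :=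
  r 0 • LinearMap.id + r 1 • x + r 2 • y + r 3 • z

theorem affineOp_apply (r : Fin 4 → k) (x y z : V →ₗ[k] V) (v : V) :
    affineOp r x y z v = r 0 • v + r 1 • x v + r 2 • y v + r 3 • z v := by
  simp [affineOp]

/-- The induction step on the exponent of the first variable: the third relation is assumed at the
single vector `w` and passes to `x w`. -/
theorem OverlapResolvable.relation_apply {a b c : k} {p q s : Fin 4 → k}
    (h : OverlapResolvable a b c p q s) {x y z : V →ₗ[k] V}
    (hyx : ∀ v, y (x v) = c • x (y v) + affineOp p x y z v)
    (hzx : ∀ v, z (x v) = b • x (z v) + affineOp q x y z v) {w : V}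
    (hzy : z (y w) = a • y (z w) + affineOp s x y z w) :
    z (y (x w)) = a • y (z (x w)) + affineOp s x y z (x w) := by
  obtain ⟨h1, h2, h3, h4, h5, h6, h7, h8, h9, h10⟩ := h
  simp only [affineOp_apply] at *
  simp only [hyx, hzx, hzy, map_add, map_smul]
  match_scalars
  -- The coefficient of `x (y (z w))` is the product of `a`, `b`, `c` on both sides; each other goal
  -- is one of the ten equations.
  · ring
  · linear_combination h1
  · linear_combination h7
  · linear_combination h4
  · linear_combination h5
  · linear_combination h2
  · linear_combination h8
  · linear_combination h6
  · linear_combination h10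
  · linear_combination h3
  · linear_combination h9

end Operators

/-! ### Operators on the free module on the standard monomials -/

/-- The free module on the standard monomials. -/
abbrev MonomialModule (k : Type*) [Field k] : Type _ := ℕ × ℕ × ℕ →₀ k

/-- The total degree of a standard monomial. -/
def monDeg (m : ℕ × ℕ × ℕ) : ℕ := m.1 + m.2.1 + m.2.2

/-- The span of the standard monomials of degree less than `n`. -/
def degLT (k : Type*) [Field k] (n : ℕ) : Submodule k (MonomialModule k) :=
  Submodule.span k ((fun m => Finsupp.single m 1) '' {m | monDeg m < n})

theorem single_mem_degLT {m : ℕ × ℕ × ℕ} {n : ℕ} (h : monDeg m < n) :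
    Finsupp.single m (1 : k) ∈ degLT k n :=
  Submodule.subset_span ⟨m, h, rfl⟩

theorem degLT_mono {m n : ℕ} (h : m ≤ n) : degLT k m ≤ degLT k n :=
  Submodule.span_mono (Set.image_mono fun _ h' => lt_of_lt_of_le h' h)

/-- An operator raising the degree by at most one. -/
def IsFiltered (f : MonomialModule k →ₗ[k] MonomialModule k) : Prop :=
  ∀ m, f (Finsupp.single m 1) ∈ degLT k (monDeg m + 2)

theorem IsFiltered.apply_mem {f : MonomialModule k →ₗ[k] MonomialModule k} (hf : IsFiltered f)
    {n : ℕ} {v : MonomialModule k} (hv : v ∈ degLT k n) : f v ∈ degLT k (n + 1) := by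
  suffices degLT k n ≤ (degLT k (n + 1)).comap f from this hv
  refine Submodule.span_le.2 ?_
  rintro _ ⟨m, hm, rfl⟩
  exact degLT_mono (Nat.succ_le_succ hm) (hf m)

theorem eqOn_degLT {f g : MonomialModule k →ₗ[k] MonomialModule k} {n : ℕ}
    (h : ∀ m, monDeg m < n → f (Finsupp.single m 1) = g (Finsupp.single m 1))
    {v : MonomialModule k} (hv : v ∈ degLT k n) : f v = g v := by
  have : Set.EqOn f g (degLT k n) := LinearMap.eqOn_span (by rintro _ ⟨m, hm, rfl⟩; exact h m hm)
  exact this hv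

/-- Left multiplication by the first variable on standard monomials. -/
def opX (k : Type*) [Field k] : MonomialModule k →ₗ[k] MonomialModule k :=
  Finsupp.linearCombination k fun m => Finsupp.single (m.1 + 1, m.2) 1

theorem opX_single (i j l : ℕ) :
    opX k (Finsupp.single (i, j, l) 1) = Finsupp.single (i + 1, j, l) 1 := by
  simp [opX]

theorem isFiltered_opX : IsFiltered (opX k) := by
  rintro ⟨i, j, l⟩
  rw [opX_single]
  exact single_mem_degLT (by simp only [monDeg]; omega)

theorem affineOp_apply_mem (r : Fin 4 → k) {y z : MonomialModule k →ₗ[k] MonomialModule k}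
    (hy : IsFiltered y) (hz : IsFiltered z) {n : ℕ} {v : MonomialModule k} (hv : v ∈ degLT k n) :
    affineOp r (opX k) y z v ∈ degLT k (n + 1) := by
  rw [affineOp_apply]
  exact add_mem (add_mem (add_mem (Submodule.smul_mem _ _ (degLT_mono n.le_succ hv))
    (Submodule.smul_mem _ _ (isFiltered_opX.apply_mem hv)))
    (Submodule.smul_mem _ _ (hy.apply_mem hv))) (Submodule.smul_mem _ _ (hz.apply_mem hv))

/-- The operator of left multiplication by the second variable, one degree further than the
approximations `y`, `z`. -/
def stepY (c : k) (p : Fin 4 → k) (y z : MonomialModule k →ₗ[k] MonomialModule k) :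
    MonomialModule k →ₗ[k] MonomialModule k :=
  Finsupp.linearCombination k fun
    | (0, j, l) => Finsupp.single (0, j + 1, l) 1
    | (i + 1, j, l) => c • opX k (y (Finsupp.single (i, j, l) 1)) +
        affineOp p (opX k) y z (Finsupp.single (i, j, l) 1)

/-- The operator of left multiplication by the third variable, one degree further than the
approximations `y`, `z`; the operator `y'` is the improved approximation of `y`. -/
def stepZ (a b : k) (q s : Fin 4 → k) (y' y z : MonomialModule k →ₗ[k] MonomialModule k) :
    MonomialModule k →ₗ[k] MonomialModule k :=
  Finsupp.linearCombination k fun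
    | (0, 0, l) => Finsupp.single (0, 0, l + 1) 1
    | (0, j + 1, l) => a • y' (z (Finsupp.single (0, j, l) 1)) +
        affineOp s (opX k) y z (Finsupp.single (0, j, l) 1)
    | (i + 1, j, l) => b • opX k (z (Finsupp.single (i, j, l) 1)) +
        affineOp q (opX k) y z (Finsupp.single (i, j, l) 1)

/-! ### One recursion step: values, degree bounds, dependence on the approximations -/

section Step

variable (a b c : k) (p q s : Fin 4 → k) (y' y z : MonomialModule k →ₗ[k] MonomialModule k)

theorem stepY_single_zero (j l : ℕ) :
    stepY c p y z (Finsupp.single (0, j, l) 1) = Finsupp.single (0, j + 1, l) 1 := by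
  simp [stepY]

theorem stepY_single_succ (i j l : ℕ) :
    stepY c p y z (Finsupp.single (i + 1, j, l) 1) =
      c • opX k (y (Finsupp.single (i, j, l) 1)) +
        affineOp p (opX k) y z (Finsupp.single (i, j, l) 1) := by
  simp [stepY]

theorem stepZ_single_zero_zero (l : ℕ) :
    stepZ a b q s y' y z (Finsupp.single (0, 0, l) 1) = Finsupp.single (0, 0, l + 1) 1 := by
  simp [stepZ]

theorem stepZ_single_zero_succ (j l : ℕ) :
    stepZ a b q s y' y z (Finsupp.single (0, j + 1, l) 1) =
      a • y' (z (Finsupp.single (0, j, l) 1)) +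
        affineOp s (opX k) y z (Finsupp.single (0, j, l) 1) := by
  simp [stepZ]

theorem stepZ_single_succ (i j l : ℕ) :
    stepZ a b q s y' y z (Finsupp.single (i + 1, j, l) 1) =
      b • opX k (z (Finsupp.single (i, j, l) 1)) +
        affineOp q (opX k) y z (Finsupp.single (i, j, l) 1) := by
  simp [stepZ]

variable {y' y z}

theorem isFiltered_stepY (hy : IsFiltered y) (hz : IsFiltered z) :
    IsFiltered (stepY c p y z) := by
  rintro ⟨_ | i, j, l⟩
  · rw [stepY_single_zero]
    exact single_mem_degLT (by simp only [monDeg]; omega)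
  · rw [stepY_single_succ]
    have hm : Finsupp.single (i, j, l) (1 : k) ∈ degLT k (i + j + l + 1) :=
      single_mem_degLT (by simp only [monDeg]; omega)
    refine degLT_mono (m := i + j + l + 1 + 1 + 1) (by simp only [monDeg]; omega) ?_
    exact add_mem (Submodule.smul_mem _ _ (isFiltered_opX.apply_mem (hy.apply_mem hm)))
      (degLT_mono (Nat.le_succ _) (affineOp_apply_mem p hy hz hm))

theorem isFiltered_stepZ (hy' : IsFiltered y') (hy : IsFiltered y) (hz : IsFiltered z) :
    IsFiltered (stepZ a b q s y' y z) := by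
  rintro ⟨_ | i, j, l⟩
  · obtain _ | j := j
    · rw [stepZ_single_zero_zero]
      exact single_mem_degLT (by simp only [monDeg]; omega)
    · rw [stepZ_single_zero_succ]
      have hm : Finsupp.single (0, j, l) (1 : k) ∈ degLT k (j + l + 1) :=
        single_mem_degLT (by simp only [monDeg]; omega)
      refine degLT_mono (m := j + l + 1 + 1 + 1) (by simp only [monDeg]; omega) ?_
      exact add_mem (Submodule.smul_mem _ _ (hy'.apply_mem (hz.apply_mem hm)))
        (degLT_mono (Nat.le_succ _) (affineOp_apply_mem s hy hz hm))
  · rw [stepZ_single_succ]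
    have hm : Finsupp.single (i, j, l) (1 : k) ∈ degLT k (i + j + l + 1) :=
      single_mem_degLT (by simp only [monDeg]; omega)
    refine degLT_mono (m := i + j + l + 1 + 1 + 1) (by simp only [monDeg]; omega) ?_
    exact add_mem (Submodule.smul_mem _ _ (isFiltered_opX.apply_mem (hz.apply_mem hm)))
      (degLT_mono (Nat.le_succ _) (affineOp_apply_mem q hy hz hm))

variable {y₁ z₁ y₁' : MonomialModule k →ₗ[k] MonomialModule k} {n : ℕ}

theorem stepY_congr
    (hy : ∀ m, monDeg m < n → y (Finsupp.single m 1) = y₁ (Finsupp.single m 1))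
    (hz : ∀ m, monDeg m < n → z (Finsupp.single m 1) = z₁ (Finsupp.single m 1))
    (m : ℕ × ℕ × ℕ) (hm : monDeg m < n + 1) :
    stepY c p y z (Finsupp.single m 1) = stepY c p y₁ z₁ (Finsupp.single m 1) := by
  obtain ⟨_ | i, j, l⟩ := m
  · simp only [stepY_single_zero]
  · have h : monDeg (i, j, l) < n := by simp only [monDeg] at hm ⊢; omega
    simp only [stepY_single_succ, affineOp_apply, hy _ h, hz _ h]

/-- In `stepZ` the operator `y'` is applied to `z` of a monomial, which may have one degree more
than that monomial. Hence `y'` must agree one degree further than `y` and `z`, and `z` must be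
filtered. -/
theorem stepZ_congr (hz_filt : IsFiltered z)
    (hy' : ∀ m, monDeg m < n + 1 → y' (Finsupp.single m 1) = y₁' (Finsupp.single m 1))
    (hy : ∀ m, monDeg m < n → y (Finsupp.single m 1) = y₁ (Finsupp.single m 1))
    (hz : ∀ m, monDeg m < n → z (Finsupp.single m 1) = z₁ (Finsupp.single m 1))
    (m : ℕ × ℕ × ℕ) (hm : monDeg m < n + 1) :
    stepZ a b q s y' y z (Finsupp.single m 1) =
      stepZ a b q s y₁' y₁ z₁ (Finsupp.single m 1) := by
  obtain ⟨_ | i, j, l⟩ := m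
  · obtain _ | j := j
    · simp only [stepZ_single_zero_zero]
    · have h : monDeg (0, j, l) < n := by simp only [monDeg] at hm ⊢; omega
      have h' := eqOn_degLT hy' (hz_filt.apply_mem (single_mem_degLT h))
      simp only [stepZ_single_zero_succ, affineOp_apply, h', ← hy _ h, ← hz _ h]
  · have h : monDeg (i, j, l) < n := by simp only [monDeg] at hm ⊢; omega
    simp only [stepZ_single_succ, affineOp_apply, hy _ h, hz _ h]

end Step

/-! ### The limit operators, their commutation relations and independence -/

section FixedPoint

variable (a b c : k) (p q s : Fin 4 → k)

/-- The approximations of the operators of left multiplication by the second and the third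
variable that are correct in degrees less than `n`. -/
def opApprox : ℕ → (MonomialModule k →ₗ[k] MonomialModule k) ×
    (MonomialModule k →ₗ[k] MonomialModule k)
  | 0 => (0, 0)
  | n + 1 =>
    (stepY c p (opApprox n).1 (opApprox n).2,
      stepZ a b q s (stepY c p (opApprox n).1 (opApprox n).2) (opApprox n).1 (opApprox n).2)

theorem isFiltered_opApprox (n : ℕ) :
    IsFiltered (opApprox a b c p q s n).1 ∧ IsFiltered (opApprox a b c p q s n).2 := by
  induction n with
  | zero => exact ⟨fun m => zero_mem _, fun m => zero_mem _⟩
  | succ n ih =>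
    have h := isFiltered_stepY c p ih.1 ih.2
    exact ⟨h, isFiltered_stepZ a b q s h ih.1 ih.2⟩

theorem opApprox_succ_single (n : ℕ) :
    (∀ m, monDeg m < n → (opApprox a b c p q s n).1 (Finsupp.single m 1) =
      (opApprox a b c p q s (n + 1)).1 (Finsupp.single m 1)) ∧
    ∀ m, monDeg m < n → (opApprox a b c p q s n).2 (Finsupp.single m 1) =
      (opApprox a b c p q s (n + 1)).2 (Finsupp.single m 1) := by
  induction n with
  | zero =>
    exact ⟨fun m hm => absurd hm (Nat.not_lt_zero _), fun m hm => absurd hm (Nat.not_lt_zero _)⟩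
  | succ n ih =>
    have h := stepY_congr c p ih.1 ih.2
    exact ⟨h, stepZ_congr a b q s (isFiltered_opApprox a b c p q s n).2 h ih.1 ih.2⟩

theorem opApprox_single {m : ℕ × ℕ × ℕ} {n : ℕ} (h : monDeg m < n) :
    (opApprox a b c p q s (monDeg m + 1)).1 (Finsupp.single m 1) =
      (opApprox a b c p q s n).1 (Finsupp.single m 1) ∧
    (opApprox a b c p q s (monDeg m + 1)).2 (Finsupp.single m 1) =
      (opApprox a b c p q s n).2 (Finsupp.single m 1) := by
  induction n, h using Nat.le_induction with
  | base => exact ⟨rfl, rfl⟩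
  | succ n hn ih =>
    have h := opApprox_succ_single a b c p q s n
    exact ⟨ih.1.trans (h.1 m hn), ih.2.trans (h.2 m hn)⟩

/-- Left multiplication by the second variable on standard monomials. -/
def opY : MonomialModule k →ₗ[k] MonomialModule k :=
  Finsupp.linearCombination k fun m =>
    (opApprox a b c p q s (monDeg m + 1)).1 (Finsupp.single m 1)

/-- Left multiplication by the third variable on standard monomials. -/
def opZ : MonomialModule k →ₗ[k] MonomialModule k :=
  Finsupp.linearCombination k fun m =>
    (opApprox a b c p q s (monDeg m + 1)).2 (Finsupp.single m 1)

theorem opApprox_eq_op (n : ℕ) :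
    (∀ m, monDeg m < n → (opApprox a b c p q s n).1 (Finsupp.single m 1) =
      opY a b c p q s (Finsupp.single m 1)) ∧
    ∀ m, monDeg m < n → (opApprox a b c p q s n).2 (Finsupp.single m 1) =
      opZ a b c p q s (Finsupp.single m 1) := by
  constructor <;> intro m hm
  · simp [opY, (opApprox_single a b c p q s hm).1]
  · simp [opZ, (opApprox_single a b c p q s hm).2]

/-- At `m`, a step only uses values in degrees below `monDeg m`. There the limit agrees with the
approximation of index `monDeg m`, whose step is the next approximation, already final at `m`. -/
theorem stepY_op :
    stepY c p (opY a b c p q s) (opZ a b c p q s) = opY a b c p q s := by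
  refine Finsupp.lhom_ext' fun m => LinearMap.ext_ring ?_
  have h := opApprox_eq_op a b c p q s (monDeg m)
  have h' := opApprox_eq_op a b c p q s (monDeg m + 1)
  exact (stepY_congr c p h.1 h.2 m (Nat.lt_succ_self _)).symm.trans (h'.1 m (Nat.lt_succ_self _))

theorem stepZ_op :
    stepZ a b q s (opY a b c p q s) (opY a b c p q s) (opZ a b c p q s) = opZ a b c p q s := by
  refine Finsupp.lhom_ext' fun m => LinearMap.ext_ring ?_
  have h := opApprox_eq_op a b c p q s (monDeg m)
  have h' := opApprox_eq_op a b c p q s (monDeg m + 1)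
  exact (stepZ_congr a b q s (isFiltered_opApprox a b c p q s _).2 h'.1 h.1 h.2 m
    (Nat.lt_succ_self _)).symm.trans (h'.2 m (Nat.lt_succ_self _))

theorem opY_single_zero (j l : ℕ) :
    opY a b c p q s (Finsupp.single (0, j, l) 1) = Finsupp.single (0, j + 1, l) 1 := by
  rw [← stepY_op, stepY_single_zero]

theorem opZ_single_zero_zero (l : ℕ) :
    opZ a b c p q s (Finsupp.single (0, 0, l) 1) = Finsupp.single (0, 0, l + 1) 1 := by
  rw [← stepZ_op, stepZ_single_zero_zero]

/-- This needs no condition on the parameters: `opX` shifts the first exponent, so on basis vectors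
it is the successor case of `stepY` at the fixed point. -/
theorem opY_opX (v : MonomialModule k) :
    opY a b c p q s (opX k v) = c • opX k (opY a b c p q s v) +
      affineOp p (opX k) (opY a b c p q s) (opZ a b c p q s) v := by
  suffices opY a b c p q s ∘ₗ opX k = c • (opX k ∘ₗ opY a b c p q s) +
      affineOp p (opX k) (opY a b c p q s) (opZ a b c p q s) from LinearMap.congr_fun this v
  refine Finsupp.lhom_ext' fun m => LinearMap.ext_ring ?_
  obtain ⟨i, j, l⟩ := m
  have h := stepY_single_succ c p (opY a b c p q s) (opZ a b c p q s) i j l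
  rw [stepY_op, ← opX_single] at h
  exact h

theorem opZ_opX (v : MonomialModule k) :
    opZ a b c p q s (opX k v) = b • opX k (opZ a b c p q s v) +
      affineOp q (opX k) (opY a b c p q s) (opZ a b c p q s) v := by
  suffices opZ a b c p q s ∘ₗ opX k = b • (opX k ∘ₗ opZ a b c p q s) +
      affineOp q (opX k) (opY a b c p q s) (opZ a b c p q s) from LinearMap.congr_fun this v
  refine Finsupp.lhom_ext' fun m => LinearMap.ext_ring ?_
  obtain ⟨i, j, l⟩ := m
  have h := stepZ_single_succ a b q s (opY a b c p q s) (opY a b c p q s) (opZ a b c p q s) i j l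
  rw [stepZ_op, ← opX_single] at h
  exact h

variable {a b c p q s}

/-- Induction on the exponent of the first variable. At exponent zero `opY` is a plain shift and the
relation is a defining case of `stepZ`; the overlap equations enter only in the successor case. -/
theorem OverlapResolvable.opZ_opY (h : OverlapResolvable a b c p q s) (v : MonomialModule k) :
    opZ a b c p q s (opY a b c p q s v) = a • opY a b c p q s (opZ a b c p q s v) +
      affineOp s (opX k) (opY a b c p q s) (opZ a b c p q s) v := by
  suffices opZ a b c p q s ∘ₗ opY a b c p q s = a • (opY a b c p q s ∘ₗ opZ a b c p q s) +
      affineOp s (opX k) (opY a b c p q s) (opZ a b c p q s) from LinearMap.congr_fun this v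
  refine Finsupp.lhom_ext' fun m => LinearMap.ext_ring ?_
  obtain ⟨i, j, l⟩ := m
  change opZ a b c p q s (opY a b c p q s (Finsupp.single (i, j, l) 1)) =
    a • opY a b c p q s (opZ a b c p q s (Finsupp.single (i, j, l) 1)) +
      affineOp s (opX k) (opY a b c p q s) (opZ a b c p q s) (Finsupp.single (i, j, l) 1)
  induction i with
  | zero =>
    have h := stepZ_single_zero_succ a b q s (opY a b c p q s) (opY a b c p q s)
      (opZ a b c p q s) j l
    rwa [stepZ_op, ← opY_single_zero a b c p q s] at h
  | succ i ih =>
    rw [← opX_single]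
    exact h.relation_apply (opY_opX a b c p q s) (opZ_opX a b c p q s) ih

variable (a b c p q s)

/-- The operators of left multiplication by the variables on standard monomials. -/
def opGen : Fin 3 → Module.End k (MonomialModule k) :=
  ![opX k, opY a b c p q s, opZ a b c p q s]

/-- The powers act from the right, so `opZ` meets only indices `(0, 0, l)` and `opY` only `(0, j,
l)`, where both are plain shifts. -/
theorem stdMonomial_opGen_apply (m : ℕ × ℕ × ℕ) :
    stdMonomial (opGen a b c p q s) m (Finsupp.single (0, 0, 0) 1) = Finsupp.single m 1 := by
  obtain ⟨i, j, l⟩ := m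
  have hZ : (opZ a b c p q s ^ l) (Finsupp.single (0, 0, 0) 1) = Finsupp.single (0, 0, l) 1 := by
    induction l with
    | zero => rfl
    | succ l ih => rw [pow_succ', Module.End.mul_apply, ih, opZ_single_zero_zero]
  have hY : (opY a b c p q s ^ j) (Finsupp.single (0, 0, l) 1) = Finsupp.single (0, j, l) 1 := by
    induction j with
    | zero => rfl
    | succ j ih => rw [pow_succ', Module.End.mul_apply, ih, opY_single_zero]
  have hX : (opX k ^ i) (Finsupp.single (0, j, l) 1) = Finsupp.single (i, j, l) 1 := by
    induction i with
    | zero => rfl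
    | succ i ih => rw [pow_succ', Module.End.mul_apply, ih, opX_single]
  change (opX k ^ i * opY a b c p q s ^ j * opZ a b c p q s ^ l) (Finsupp.single (0, 0, 0) 1) = _
  rw [Module.End.mul_apply, hZ, Module.End.mul_apply, hY, hX]

theorem linearIndependent_stdMonomial_opGen :
    LinearIndependent k (stdMonomial (opGen a b c p q s)) := by
  refine LinearIndependent.of_comp (LinearMap.applyₗ (Finsupp.single (0, 0, 0) (1 : k))) ?_
  have : (LinearMap.applyₗ (Finsupp.single (0, 0, 0) (1 : k)) : _ →ₗ[k] MonomialModule k) ∘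
      stdMonomial (opGen a b c p q s) = fun m => Finsupp.single m 1 :=
    funext fun m => stdMonomial_opGen_apply a b c p q s m
  rw [this]
  exact Finsupp.linearIndependent_single_one k _

end FixedPoint

/-! ### Standard monomials in an algebra satisfying the relations -/

section Algebra

variable {A B : Type*} [Ring A] [Algebra k A] [Ring B] [Algebra k B]

/-- The affine combination `r₀ + r₁ x₁ + r₂ x₂ + r₃ x₃` of three elements. -/
def affineEval (r : Fin 4 → k) (x : Fin 3 → A) : A :=
  r 0 • 1 + r 1 • x 0 + r 2 • x 1 + r 3 • x 2

/-- The elements `x₁, x₂, x₃` satisfy `x₃x₂ = a x₂x₃ + s`, `x₃x₁ = b x₁x₃ + q` and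
`x₂x₁ = c x₁x₂ + p`. -/
structure SatisfiesRelations (a b c : k) (p q s : Fin 4 → k) (x : Fin 3 → A) : Prop where
  zy : x 2 * x 1 = a • (x 1 * x 2) + affineEval s x
  zx : x 2 * x 0 = b • (x 0 * x 2) + affineEval q x
  yx : x 1 * x 0 = c • (x 0 * x 1) + affineEval p x

theorem lift_affine (r : Fin 4 → k) (x : Fin 3 → A) :
    FreeAlgebra.lift k x (affine r) = affineEval r x := by
  simp [affine, affineEval, X, Algebra.algebraMap_eq_smul_one]

theorem map_stdMonomial (f : A →ₐ[k] B) (x : Fin 3 → A) (m : ℕ × ℕ × ℕ) :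
    f (stdMonomial x m) = stdMonomial (fun i => f (x i)) m := by
  simp [stdMonomial]

theorem linearCombination_stdMonomial (x : Fin 3 → A) (g : ℕ × ℕ × ℕ →₀ k) :
    Finsupp.linearCombination k (stdMonomial x) g =
      FreeAlgebra.lift k x (Finsupp.linearCombination k (stdMonomial (X k)) g) := by
  simp [Finsupp.linearCombination_apply, map_finsuppSum, map_stdMonomial, X]

/-- A linear relation among standard monomials lifts to an element of the free algebra in the first
kernel, hence in the second. -/
theorem linearIndependent_stdMonomial_of_ker_le {x : Fin 3 → A} {x' : Fin 3 → B}
    (hker : TwoSidedIdeal.ker (FreeAlgebra.lift k x) ≤ TwoSidedIdeal.ker (FreeAlgebra.lift k x'))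
    (h : LinearIndependent k (stdMonomial x')) : LinearIndependent k (stdMonomial x) := by
  rw [linearIndependent_iff]
  intro g hg
  refine linearIndependent_iff.1 h g ?_
  rw [linearCombination_stdMonomial, ← TwoSidedIdeal.mem_ker] at hg ⊢
  exact hker hg

variable {a b c : k} {p q s : Fin 4 → k} {x : Fin 3 → A}

theorem OverlapResolvable.satisfiesRelations_opGen (h : OverlapResolvable a b c p q s) :
    SatisfiesRelations a b c p q s (opGen a b c p q s) where
  zy := LinearMap.ext h.opZ_opY
  zx := LinearMap.ext (opZ_opX a b c p q s)
  yx := LinearMap.ext (opY_opX a b c p q s)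

theorem SatisfiesRelations.overlapResolvable (hx : SatisfiesRelations a b c p q s x)
    (hli : LinearIndependent k (stdMonomial x)) : OverlapResolvable a b c p q s := by
  obtain ⟨hzy, hzx, hyx⟩ := hx
  -- Forms of the relations with a tail `w`, needed once products are associated to the right.
  have hyx' (w : A) : x 1 * (x 0 * w) = c • (x 0 * (x 1 * w)) + affineEval p x * w := by
    rw [← mul_assoc, hyx, add_mul, smul_mul_assoc, mul_assoc]
  have hzx' (w : A) : x 2 * (x 0 * w) = b • (x 0 * (x 2 * w)) + affineEval q x * w := by
    rw [← mul_assoc, hzx, add_mul, smul_mul_assoc, mul_assoc]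
  have h : (a • (x 1 * x 2) + affineEval s x) * x 0 =
      x 2 * (c • (x 0 * x 1) + affineEval p x) := by
    rw [← hzy, ← hyx, mul_assoc]
  simp only [affineEval, add_mul, mul_add, smul_mul_assoc, mul_smul_comm, mul_assoc, one_mul,
    mul_one, hzy, hzx, hyx, hyx', hzx'] at h
  -- Exponents of the ten monomials of degree at most two, in the order of the fields of
  -- `OverlapResolvable`.
  have hinj : Function.Injective (![(1, 0, 0), (0, 1, 0), (0, 0, 1), (1, 1, 0), (1, 0, 1),
      (0, 1, 1), (2, 0, 0), (0, 2, 0), (0, 0, 2), (0, 0, 0)] : Fin 10 → ℕ × ℕ × ℕ) := by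
    decide
  have hd := Fintype.linearIndependent_iff.1 (hli.comp _ hinj)
    ![c * b * s 0 + c * q 3 * s 1 + p 1 * q 1 + p 2 * s 1
        - (a * p 1 * q 1 + s 0 + p 1 * s 2 + q 1 * s 3),
      c * q 0 + c * q 3 * s 2 + p 1 * q 2 + p 2 * s 2
        - (a * q 0 + a * q 1 * p 2 + p 2 * s 2 + q 2 * s 3),
      c * q 3 * s 3 + p 0 + p 1 * q 3 + p 2 * s 3
        - (b * a * p 0 + a * q 1 * p 3 + s 2 * p 3 + q 3 * s 3),
      c * q 1 + c * b * s 2 - (c * a * q 1 + c * s 2),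
      c * b * s 3 + b * p 1 - (b * a * p 1 + b * s 3),
      c * a * q 3 + a * p 2 - (b * a * p 2 + a * q 3),
      c * b * s 1 - s 1, c * q 2 - a * q 2, p 3 - b * a * p 3,
      c * q 3 * s 0 + p 1 * q 0 + p 2 * s 0 - (a * p 0 * q 1 + p 0 * s 2 + q 0 * s 3)] (by
      rw [eq_comm, ← sub_eq_zero] at h
      rw [← h]
      simp only [Fin.sum_univ_succ, Fin.sum_univ_zero, Function.comp_apply, Matrix.cons_val_zero,
        Matrix.cons_val_succ, stdMonomial, pow_zero, pow_one, pow_two, one_mul, mul_one]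
      module)
  exact ⟨sub_eq_zero.1 (hd 0), sub_eq_zero.1 (hd 1), sub_eq_zero.1 (hd 2), sub_eq_zero.1 (hd 3),
    sub_eq_zero.1 (hd 4), sub_eq_zero.1 (hd 5), sub_eq_zero.1 (hd 6), sub_eq_zero.1 (hd 7),
    sub_eq_zero.1 (hd 8), sub_eq_zero.1 (hd 9)⟩

/-! ### Spanning by standard monomials, through the degree filtration -/

/-- The span of the standard monomials of degree less than `n`. -/
def stdSpanLT (k : Type*) [Field k] {A : Type*} [Ring A] [Algebra k A] (x : Fin 3 → A) (n : ℕ) :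
    Submodule k A :=
  Submodule.span k (stdMonomial x '' {m | monDeg m < n})

theorem stdMonomial_mem_stdSpanLT (x : Fin 3 → A) {m : ℕ × ℕ × ℕ} {n : ℕ} (h : monDeg m < n) :
    stdMonomial x m ∈ stdSpanLT k x n :=
  Submodule.subset_span ⟨m, h, rfl⟩

theorem stdSpanLT_mono (x : Fin 3 → A) {m n : ℕ} (h : m ≤ n) :
    stdSpanLT k x m ≤ stdSpanLT k x n :=
  Submodule.span_mono (Set.image_mono fun _ h' => lt_of_lt_of_le h' h)

theorem mul_mem_stdSpanLT {x : Fin 3 → A} {n n' : ℕ} {u : A}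
    (h : ∀ m, monDeg m < n → u * stdMonomial x m ∈ stdSpanLT k x n') {v : A}
    (hv : v ∈ stdSpanLT k x n) : u * v ∈ stdSpanLT k x n' := by
  suffices stdSpanLT k x n ≤ (stdSpanLT k x n').comap (LinearMap.mulLeft k u) from this hv
  refine Submodule.span_le.2 ?_
  rintro _ ⟨m, hm, rfl⟩
  exact h m hm

theorem stdMonomial_succ (x : Fin 3 → A) (i j l : ℕ) :
    stdMonomial x (i + 1, j, l) = x 0 * stdMonomial x (i, j, l) := by
  simp [stdMonomial, pow_succ', mul_assoc]

theorem stdMonomial_zero_succ (x : Fin 3 → A) (j l : ℕ) :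
    stdMonomial x (0, j + 1, l) = x 1 * stdMonomial x (0, j, l) := by
  simp [stdMonomial, pow_succ', mul_assoc]

theorem stdMonomial_zero_zero_succ (x : Fin 3 → A) (l : ℕ) :
    stdMonomial x (0, 0, l + 1) = x 2 * stdMonomial x (0, 0, l) := by
  simp [stdMonomial, pow_succ']

theorem x_mul_mem_stdSpanLT (x : Fin 3 → A) {n : ℕ} {v : A} (hv : v ∈ stdSpanLT k x n) :
    x 0 * v ∈ stdSpanLT k x (n + 1) := by
  refine mul_mem_stdSpanLT (fun m hm => ?_) hv
  obtain ⟨i, j, l⟩ := m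
  rw [← stdMonomial_succ]
  exact stdMonomial_mem_stdSpanLT x (by simp only [monDeg] at hm ⊢; omega)

theorem affineEval_mul_mem_stdSpanLT (r : Fin 4 → k) {n : ℕ}
    (hy : ∀ v ∈ stdSpanLT k x n, x 1 * v ∈ stdSpanLT k x (n + 1))
    (hz : ∀ v ∈ stdSpanLT k x n, x 2 * v ∈ stdSpanLT k x (n + 1))
    {v : A} (hv : v ∈ stdSpanLT k x n) : affineEval r x * v ∈ stdSpanLT k x (n + 1) := by
  simp only [affineEval, add_mul, smul_mul_assoc, one_mul]
  exact add_mem (add_mem (add_mem (Submodule.smul_mem _ _ (stdSpanLT_mono x n.le_succ hv))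
    (Submodule.smul_mem _ _ (x_mul_mem_stdSpanLT x hv)))
    (Submodule.smul_mem _ _ (hy v hv))) (Submodule.smul_mem _ _ (hz v hv))

theorem SatisfiesRelations.mul_mem_stdSpanLT (hx : SatisfiesRelations a b c p q s x) (n : ℕ) :
    (∀ v ∈ stdSpanLT k x n, x 1 * v ∈ stdSpanLT k x (n + 1)) ∧
      ∀ v ∈ stdSpanLT k x n, x 2 * v ∈ stdSpanLT k x (n + 1) := by
  induction n with
  | zero =>
    constructor <;> intro v hv <;>
      exact SkewPoly.mul_mem_stdSpanLT (fun m hm => absurd hm (Nat.not_lt_zero _)) hv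
  | succ n ih =>
    -- The bound for `x 1` comes first at this level: rewriting `x 2 * x 1` applies `x 1` to an
    -- element already raised to level `n + 1` by `x 2`.
    have hy : ∀ v ∈ stdSpanLT k x (n + 1), x 1 * v ∈ stdSpanLT k x (n + 1 + 1) := by
      intro v hv
      refine SkewPoly.mul_mem_stdSpanLT (fun m hm => ?_) hv
      obtain ⟨_ | i, j, l⟩ := m
      · rw [← stdMonomial_zero_succ]
        exact stdMonomial_mem_stdSpanLT x (by simp only [monDeg] at hm ⊢; omega)
      · have h : stdMonomial x (i, j, l) ∈ stdSpanLT k x n :=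
          stdMonomial_mem_stdSpanLT x (by simp only [monDeg] at hm ⊢; omega)
        rw [stdMonomial_succ, ← mul_assoc, hx.yx, add_mul, smul_mul_assoc, mul_assoc]
        exact add_mem (Submodule.smul_mem _ _ (x_mul_mem_stdSpanLT x (ih.1 _ h)))
          (stdSpanLT_mono x (Nat.le_succ _) (affineEval_mul_mem_stdSpanLT p ih.1 ih.2 h))
    refine ⟨hy, fun v hv => SkewPoly.mul_mem_stdSpanLT (fun m hm => ?_) hv⟩
    obtain ⟨_ | i, j, l⟩ := m
    · obtain _ | j := j
      · rw [← stdMonomial_zero_zero_succ]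
        exact stdMonomial_mem_stdSpanLT x (by simp only [monDeg] at hm ⊢; omega)
      · have h : stdMonomial x (0, j, l) ∈ stdSpanLT k x n :=
          stdMonomial_mem_stdSpanLT x (by simp only [monDeg] at hm ⊢; omega)
        rw [stdMonomial_zero_succ, ← mul_assoc, hx.zy, add_mul, smul_mul_assoc, mul_assoc]
        exact add_mem (Submodule.smul_mem _ _ (hy _ (ih.2 _ h)))
          (stdSpanLT_mono x (Nat.le_succ _) (affineEval_mul_mem_stdSpanLT s ih.1 ih.2 h))
    · have h : stdMonomial x (i, j, l) ∈ stdSpanLT k x n :=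
        stdMonomial_mem_stdSpanLT x (by simp only [monDeg] at hm ⊢; omega)
      rw [stdMonomial_succ, ← mul_assoc, hx.zx, add_mul, smul_mul_assoc, mul_assoc]
      exact add_mem (Submodule.smul_mem _ _ (x_mul_mem_stdSpanLT x (ih.2 _ h)))
        (stdSpanLT_mono x (Nat.le_succ _) (affineEval_mul_mem_stdSpanLT q ih.1 ih.2 h))

/-- The span is stable under left multiplication by the generators, so it is a left ideal; it
contains `1`. -/
theorem SatisfiesRelations.span_stdMonomial (hx : SatisfiesRelations a b c p q s x)
    (hsurj : Function.Surjective (FreeAlgebra.lift k x)) :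
    Submodule.span k (Set.range (stdMonomial x)) = ⊤ := by
  have hle (n : ℕ) : stdSpanLT k x n ≤ Submodule.span k (Set.range (stdMonomial x)) :=
    Submodule.span_mono (Set.image_subset_range _ _)
  have hgen (i : Fin 3) : ∀ v ∈ Submodule.span k (Set.range (stdMonomial x)),
      x i * v ∈ Submodule.span k (Set.range (stdMonomial x)) := by
    suffices Submodule.span k (Set.range (stdMonomial x)) ≤
        (Submodule.span k (Set.range (stdMonomial x))).comap (LinearMap.mulLeft k (x i)) from
      fun v hv => this hv
    refine Submodule.span_le.2 ?_
    rintro _ ⟨m, rfl⟩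
    have hm : stdMonomial x m ∈ stdSpanLT k x (monDeg m + 1) :=
      stdMonomial_mem_stdSpanLT x (Nat.lt_succ_self _)
    have h := hx.mul_mem_stdSpanLT (monDeg m + 1)
    refine hle (monDeg m + 1 + 1) ?_
    change x i * stdMonomial x m ∈ _
    fin_cases i
    exacts [x_mul_mem_stdSpanLT x hm, h.1 _ hm, h.2 _ hm]
  have hmul (f : Free3 k) : ∀ v ∈ Submodule.span k (Set.range (stdMonomial x)),
      FreeAlgebra.lift k x f * v ∈ Submodule.span k (Set.range (stdMonomial x)) := by
    induction f using FreeAlgebra.induction with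
    | grade0 r =>
      intro v hv
      rw [AlgHom.commutes, ← Algebra.smul_def]
      exact Submodule.smul_mem _ _ hv
    | grade1 i => simpa using hgen i
    | mul f g hf hg =>
      intro v hv
      rw [map_mul, mul_assoc]
      exact hf _ (hg v hv)
    | add f g hf hg =>
      intro v hv
      rw [map_add, add_mul]
      exact add_mem (hf v hv) (hg v hv)
  refine eq_top_iff.2 fun v _ => ?_
  obtain ⟨f, rfl⟩ := hsurj v
  simpa using hmul f 1 (Submodule.subset_span ⟨(0, 0, 0), by simp [stdMonomial]⟩)

end Algebra

/-! ### The algebra defined by the relations -/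

section RelAlgebra

variable (α β γ : k) (r12 r13 r23 : Fin 4 → k)

theorem lift_gen_apply (f : Free3 k) :
    FreeAlgebra.lift k (gen α β γ r12 r13 r23) f =
      (relIdeal α β γ r12 r13 r23).ringCon.mk' f := by
  induction f using FreeAlgebra.induction with
  | grade0 r => rw [AlgHom.commutes]; rfl
  | grade1 i => rw [FreeAlgebra.lift_ι_apply]; rfl
  | mul f g hf hg => rw [map_mul, map_mul, hf, hg]
  | add f g hf hg => rw [map_add, map_add, hf, hg]

theorem lift_gen_surjective : Function.Surjective (FreeAlgebra.lift k (gen α β γ r12 r13 r23)) := by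
  intro v
  obtain ⟨f, rfl⟩ := RingCon.mk'_surjective (relIdeal α β γ r12 r13 r23).ringCon v
  exact ⟨f, lift_gen_apply α β γ r12 r13 r23 f⟩

theorem ker_lift_gen :
    TwoSidedIdeal.ker (FreeAlgebra.lift k (gen α β γ r12 r13 r23)) =
      relIdeal α β γ r12 r13 r23 := by
  ext f
  rw [TwoSidedIdeal.mem_ker, lift_gen_apply, TwoSidedIdeal.mem_iff]
  exact RingCon.eq _

theorem satisfiesRelations_gen :
    SatisfiesRelations α⁻¹ β γ⁻¹ r12 r13 r23 (gen α β γ r12 r13 r23) := by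
  have key {f : Free3 k} (hf : f ∈ relIdeal α β γ r12 r13 r23) :
      FreeAlgebra.lift k (gen α β γ r12 r13 r23) f = 0 := by
    rwa [← ker_lift_gen, TwoSidedIdeal.mem_ker] at hf
  constructor
  · have := key (TwoSidedIdeal.subset_span (Or.inl rfl))
    simpa [lift_affine, sub_eq_zero] using this
  · have := key (TwoSidedIdeal.subset_span (Or.inr (Or.inl rfl)))
    simpa [lift_affine, sub_eq_zero] using this
  · have := key (TwoSidedIdeal.subset_span (Or.inr (Or.inr rfl)))
    simpa [lift_affine, sub_eq_zero] using this

variable {α β γ r12 r13 r23}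

theorem relIdeal_le_ker {A : Type*} [Ring A] [Algebra k A] {x : Fin 3 → A}
    (hx : SatisfiesRelations α⁻¹ β γ⁻¹ r12 r13 r23 x) :
    relIdeal α β γ r12 r13 r23 ≤ TwoSidedIdeal.ker (FreeAlgebra.lift k x) := by
  refine TwoSidedIdeal.span_le.2 ?_
  rintro f (rfl | rfl | rfl) <;>
    simp [TwoSidedIdeal.mem_ker, lift_affine, hx.zy, hx.zx, hx.yx]

theorem OverlapResolvable.linearIndependent_stdMonomial_gen
    (h : OverlapResolvable α⁻¹ β γ⁻¹ r12 r13 r23) :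
    LinearIndependent k (stdMonomial (gen α β γ r12 r13 r23)) :=
  linearIndependent_stdMonomial_of_ker_le
    ((ker_lift_gen α β γ r12 r13 r23).trans_le (relIdeal_le_ker h.satisfiesRelations_opGen))
    (linearIndependent_stdMonomial_opGen α⁻¹ β γ⁻¹ r12 r13 r23)

theorem affine_smul (t : k) (r : Fin 4 → k) : affine (t • r) = t • affine r := by
  simp only [affine, Pi.smul_apply, smul_eq_mul, Algebra.algebraMap_eq_smul_one]
  module

theorem smul_mem_twoSidedIdeal {A : Type*} [Ring A] [Algebra k A] (I : TwoSidedIdeal A) (t : k)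
    {f : A} (hf : f ∈ I) : t • f ∈ I := by
  rw [Algebra.smul_def]
  exact I.mul_mem_left _ _ hf

/-- The two sets of generators agree up to the nonzero factors `-α`, `1`, `-γ`. -/
theorem relIdeal_eq_span (hα : α ≠ 0) (hγ : γ ≠ 0) :
    relIdeal α β γ r12 r13 r23 = TwoSidedIdeal.span
      {X k 1 * X k 2 - α • (X k 2 * X k 1) - affine (-α • r23),
       X k 2 * X k 0 - β • (X k 0 * X k 2) - affine r13,
       X k 0 * X k 1 - γ • (X k 1 * X k 0) - affine (-γ • r12)} := by
  have e1 : X k 1 * X k 2 - α • (X k 2 * X k 1) - affine (-α • r23) =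
      -α • (X k 2 * X k 1 - (α⁻¹ • (X k 1 * X k 2) + affine r23)) := by
    rw [affine_smul]
    match_scalars <;> field_simp
  have e2 : X k 2 * X k 0 - β • (X k 0 * X k 2) - affine r13 =
      X k 2 * X k 0 - (β • (X k 0 * X k 2) + affine r13) := by
    abel
  have e3 : X k 0 * X k 1 - γ • (X k 1 * X k 0) - affine (-γ • r12) =
      -γ • (X k 1 * X k 0 - (γ⁻¹ • (X k 0 * X k 1) + affine r12)) := by
    rw [affine_smul]
    match_scalars <;> field_simp
  rw [e1, e2, e3]
  apply le_antisymm
  · refine TwoSidedIdeal.span_le.2 ?_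
    rintro f (rfl | rfl | rfl)
    -- The generator is recovered as `(-α)⁻¹` times its rescaled form.
    · refine (inv_smul_smul₀ (neg_ne_zero.2 hα) _).subst (motive := (· ∈ _)) ?_
      exact smul_mem_twoSidedIdeal _ _ (TwoSidedIdeal.subset_span (Or.inl rfl))
    · exact TwoSidedIdeal.subset_span (Or.inr (Or.inl rfl))
    · refine (inv_smul_smul₀ (neg_ne_zero.2 hγ) _).subst (motive := (· ∈ _)) ?_
      exact smul_mem_twoSidedIdeal _ _ (TwoSidedIdeal.subset_span (Or.inr (Or.inr rfl)))
  · refine TwoSidedIdeal.span_le.2 ?_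
    rintro f (rfl | rfl | rfl)
    · exact smul_mem_twoSidedIdeal _ _ (TwoSidedIdeal.subset_span (Or.inl rfl))
    · exact TwoSidedIdeal.subset_span (Or.inr (Or.inl rfl))
    · exact smul_mem_twoSidedIdeal _ _ (TwoSidedIdeal.subset_span (Or.inr (Or.inr rfl)))

theorem isSkewPolynomialAlgebra_gen_iff (hα : α ≠ 0) (hβ : β ≠ 0) (hγ : γ ≠ 0) :
    IsSkewPolynomialAlgebra k (gen α β γ r12 r13 r23) ↔
      OverlapResolvable α⁻¹ β γ⁻¹ r12 r13 r23 := by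
  have hrel := satisfiesRelations_gen α β γ r12 r13 r23
  have hsurj := lift_gen_surjective α β γ r12 r13 r23
  refine ⟨fun h => hrel.overlapResolvable h.2.1, fun h => ⟨⟨α, β, γ, -α • r23, r13, -γ • r12, hα,
    hβ, hγ, hsurj, ?_⟩, h.linearIndependent_stdMonomial_gen, hrel.span_stdMonomial hsurj⟩⟩
  rw [ker_lift_gen, relIdeal_eq_span hα hγ]

end RelAlgebra

end SkewPoly

end

theorem mainTheorem1 {k : Type*} [Field k] (α β γ : k) (hα : α ≠ 0) (hβ : β ≠ 0) (hγ : γ ≠ 0)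
    (r12 r13 r23 : Fin 4 → k) :
    SkewPoly.IsSkewPolynomialAlgebra k (SkewPoly.gen α β γ r12 r13 r23) ↔
      (γ⁻¹ * β * r23 0 + γ⁻¹ * r13 3 * r23 1 + r12 1 * r13 1 + r12 2 * r23 1
          = α⁻¹ * r12 1 * r13 1 + r23 0 + r12 1 * r23 2 + r13 1 * r23 3) ∧
      (γ⁻¹ * r13 0 + γ⁻¹ * r13 3 * r23 2 + r12 1 * r13 2 + r12 2 * r23 2
          = α⁻¹ * r13 0 + α⁻¹ * r13 1 * r12 2 + r12 2 * r23 2 + r13 2 * r23 3) ∧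
      (γ⁻¹ * r13 3 * r23 3 + r12 0 + r12 1 * r13 3 + r12 2 * r23 3
          = β * α⁻¹ * r12 0 + α⁻¹ * r13 1 * r12 3 + r23 2 * r12 3 + r13 3 * r23 3) ∧
      (γ⁻¹ * r13 1 + γ⁻¹ * β * r23 2 = γ⁻¹ * α⁻¹ * r13 1 + γ⁻¹ * r23 2) ∧
      (γ⁻¹ * β * r23 3 + β * r12 1 = β * α⁻¹ * r12 1 + β * r23 3) ∧
      (γ⁻¹ * α⁻¹ * r13 3 + α⁻¹ * r12 2 = β * α⁻¹ * r12 2 + α⁻¹ * r13 3) ∧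
      (γ⁻¹ * β * r23 1 = r23 1) ∧
      (γ⁻¹ * r13 2 = α⁻¹ * r13 2) ∧
      (r12 3 = β * α⁻¹ * r12 3) ∧
      (γ⁻¹ * r13 3 * r23 0 + r12 1 * r13 0 + r12 2 * r23 0
          = α⁻¹ * r12 0 * r13 1 + r12 0 * r23 2 + r13 0 * r23 3) := by
  rw [SkewPoly.isSkewPolynomialAlgebra_gen_iff hα hβ hγ]
  exact ⟨fun ⟨h1, h2, h3, h4, h5, h6, h7, h8, h9, h10⟩ => ⟨h1, h2, h3, h4, h5, h6, h7, h8, h9, h10⟩,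
    fun ⟨h1, h2, h3, h4, h5, h6, h7, h8, h9, h10⟩ => ⟨h1, h2, h3, h4, h5, h6, h7, h8, h9, h10⟩⟩
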